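/- Let $S\ge 1$, $M$ and $L\le M$ be integers with $M+1\ge 2S$, $L\ge S$ and $M-L+1\ge S$. Let $\omega_1,\dots,\omega_S\in[0,1)$ be distinct, let $x\in\mathbb C^S$ have nonzero entries, let $x_{\min}=\min_j|x_j|$, and let $\eta\in\mathbb C^{M+1}$. For an integer $N\ge 0$ and $\omega\in[0,1)$ put $\phi_N(\omega)=(1,e^{-2\pi i\omega},\dots,e^{-2\pi iN\omega})^T\in\mathbb C^{N+1}$ and $\Phi_N=[\phi_N(\omega_1)\ \cdots\ \phi_N(\omega_S)]\in\mathbb C^{(N+1)\times S}$, and let $\sigma_{\min}(\Phi_N)$ be the smallest singular value of $\Phi_N$. Let $y^0=\Phi_M x$ and $y=y^0+\eta$. For $z=(z_0,\dots,z_M)\in\mathbb C^{M+1}$ let $\mathcal H(z)=(z_{i+j})_{0\le i\le L,\ 0\le j\le M-L}\in\mathbb C^{(L+1)\times(M-L+1)}$ be its Hankel matrix. Let $$\mathcal H(y^0)=[U\ W]\,\Sigma\,V^*,\qquad \mathcal H(y)=[\hat U\ \hat W]\,\hat\Sigma\,\hat V^*$$ be any full singular value decompositions (the outer factors are unitary,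 and the singular values are in decreasing order on the diagonals of the rectangular diagonal matrices $\Sigma,\hat\Sigma$), where $U,\hat U$ consist of the first $S$ columns and $W,\hat W$ of the remaining $L+1-S$ columns. Define the noise-space correlation functions $$\mathcal R(\omega)=\frac{\|W^*\phi_L(\omega)\|_2}{\|\phi_L(\omega)\|_2},\qquad \hat{\mathcal R}(\omega)=\frac{\|\hat W^*\phi_L(\omega)\|_2}{\|\phi_L(\omega)\|_2},\qquad \omega\in[0,1).$$ If $2\|\mathcal H(\eta)\|_2<x_{\min}\,\sigma_{\min}(\Phi_L)\,\sigma_{\min}(\Phi_{M-L})$, where $\|\cdot\|_2$ is the spectral norm on matrices, then the maximum $\|\hat{\mathcal R}-\mathcal R\|_\infty:=\max_{\omega\in[0,1)}|\hat{\mathcal R}(\omega)-\mathcal R(\omega)|$ exists and $$\|\hat{\mathcal R}-\mathcal R\|_\infty\le\frac{2\|\mathcal H(\eta)\|_2}{x_{\min}\,\sigma_{\min}(\Phi_L)\,\sigma_{\min}(\Phi_{M-L})}.$$ -/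

import Mathlib

namespace MUSIC

noncomputable section

open Matrix

/-- The Euclidean (`ℓ²`) norm of a complex vector. -/
def l2norm {ι : Type*} [Fintype ι] (v : ι → ℂ) : ℝ :=
  ‖WithLp.toLp 2 v‖

/-- The spectral norm of a matrix: its operator norm between Euclidean spaces. -/
def specNorm {m n : ℕ} (A : Matrix (Fin m) (Fin n) ℂ) : ℝ :=
  ‖LinearMap.toContinuousLinearMap (Matrix.toEuclideanLin A)‖

/-- The smallest of the `min m n` singular values of an `m × n` matrix (Mathlib lists the singular
values in decreasing order, starting from index `0`). -/
def sigmaMin {m n : ℕ} (A : Matrix (Fin m) (Fin n) ℂ) : ℝ :=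
  (Matrix.toEuclideanLin A).singularValues (min m n - 1)

/-- The steering vector `φ_L(ω) = (1, e^{-2πiω}, …, e^{-2πiLω})`, of length `L + 1`. -/
def steering (L : ℕ) (ω : ℝ) : Fin (L + 1) → ℂ :=
  fun k => Complex.exp (-2 * Real.pi * Complex.I * (k : ℕ) * ω)

/-- The `(N + 1) × S` Fourier (Vandermonde) matrix `Φ_N = [φ_N(ω_1) … φ_N(ω_S)]`. -/
def fourierMatrix {S : ℕ} (N : ℕ) (ω : Fin S → ℝ) : Matrix (Fin (N + 1)) (Fin S) ℂ :=
  Matrix.of fun k j => steering N (ω j) k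

/-- The `(L + 1) × (M - L + 1)` Hankel matrix of `y ∈ ℂ^{M+1}`, with entries `y_{i+j}`. -/
def hankel {M L : ℕ} (hLM : L ≤ M) (y : Fin (M + 1) → ℂ) :
    Matrix (Fin (L + 1)) (Fin (M - L + 1)) ℂ :=
  Matrix.of fun i j => y ⟨(i : ℕ) + (j : ℕ), by omega⟩

/-- The rectangular `m × n` matrix with `σ 0, σ 1, …` on the main diagonal and zeros elsewhere. -/
def rectDiagonal (m n : ℕ) (σ : ℕ → ℝ) : Matrix (Fin m) (Fin n) ℂ :=
  Matrix.of fun i j => if (i : ℕ) = (j : ℕ) then ((σ i : ℝ) : ℂ) else 0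

/-- `A = Q diag(σ) Vᴴ` is a (full) singular value decomposition of `A`: `Q` and `V` are unitary,
and `σ` is nonnegative and listed in decreasing order. Only the first `min m n` terms of `σ`
occur in the product; the later ones carry no information. -/
structure IsSVD {m n : ℕ} (A : Matrix (Fin m) (Fin n) ℂ) (Q : Matrix (Fin m) (Fin m) ℂ)
    (σ : ℕ → ℝ) (V : Matrix (Fin n) (Fin n) ℂ) : Prop where
  left_unitary : Q ∈ Matrix.unitaryGroup (Fin m) ℂ
  right_unitary : V ∈ Matrix.unitaryGroup (Fin n) ℂ
  nonneg : ∀ i, 0 ≤ σ i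
  antitone : Antitone σ
  eq_mul : A = Q * rectDiagonal m n σ * Vᴴ

/-- The block `W` in the splitting `Q = [U W]`, where `U` consists of the first `S` columns. -/
def noiseBlock {m : ℕ} (S : ℕ) (Q : Matrix (Fin m) (Fin m) ℂ) :
    Matrix (Fin m) {i : Fin m // S ≤ (i : ℕ)} ℂ :=
  Q.submatrix id Subtype.val

/-- The noise-space correlation function `ω ↦ ‖Wᴴ φ_L(ω)‖₂ / ‖φ_L(ω)‖₂`, for the block `W` of `Q`. -/
def noiseCorrelation {L : ℕ} (S : ℕ) (Q : Matrix (Fin (L + 1)) (Fin (L + 1)) ℂ) (ω : ℝ) : ℝ :=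
  l2norm ((noiseBlock S Q)ᴴ *ᵥ steering L ω) / l2norm (steering L ω)

/-- The smallest modulus `x_min = min_j |x_j|` of the amplitudes (used for `S ≥ 1`). -/
def xMin {S : ℕ} (x : Fin S → ℂ) : ℝ :=
  ⨅ j, ‖x j‖

end

end MUSIC

namespace MUSIC

open Matrix

/-! ### Euclidean and spectral norms. -/

section Norms

variable {ι κ : Type*} [Fintype ι] [Fintype κ]

/-! Write `A`, `E` for the Hankel matrices of the clean data and the noise, `e = ‖E‖`, and `g` for
the denominator of the bound. The Vandermonde factorization `A = Φ_L diag(x) Φ_{M-L}ᵀ` gives rank at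
most `S` and `S`-th singular value at least `g`; by Weyl-type bounds `A + E` has `S`-th singular
value at least `g - e` and later ones at most `e`. A vector `u` is its noise part plus a signal part
`A v` with `‖v‖ ≤ ‖u‖ / g`. The noise projection of `A + E` maps `A v = (A + E) v - E v` to norm at
most `2e‖v‖`, so it exceeds that of `A` by at most `(2e/g)‖u‖`. With the roles exchanged the excess
is at most `(e/(g - e))‖u‖`, and `2e < g` makes this no larger. Both halves are instances of
`IsSVD.l2norm_noiseBlock_le_add`, combined in `IsSVD.abs_l2norm_noiseBlock_sub_le`. -/

lemma l2norm_nonneg (v : ι → ℂ) : 0 ≤ l2norm v := norm_nonneg _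

lemma l2norm_sq (v : ι → ℂ) : l2norm v ^ 2 = ∑ i, ‖v i‖ ^ 2 :=
  EuclideanSpace.norm_sq_eq _

lemma l2norm_add_le (u v : ι → ℂ) : l2norm (u + v) ≤ l2norm u + l2norm v :=
  norm_add_le (WithLp.toLp 2 u) (WithLp.toLp 2 v)

lemma l2norm_sub_le (u v : ι → ℂ) : l2norm (u - v) ≤ l2norm u + l2norm v :=
  norm_sub_le (WithLp.toLp 2 u) (WithLp.toLp 2 v)

lemma l2norm_zero : l2norm (0 : ι → ℂ) = 0 := by
  simp [l2norm]

lemma l2norm_star (v : ι → ℂ) : l2norm (star v) = l2norm v := by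
  rw [← sq_eq_sq₀ (l2norm_nonneg _) (l2norm_nonneg _), l2norm_sq, l2norm_sq]
  simp

lemma l2norm_pos {v : ι → ℂ} (hv : v ≠ 0) : 0 < l2norm v :=
  norm_pos_iff.2 fun h => hv (by simpa using h)

lemma ofReal_l2norm_sq (v : ι → ℂ) : ((l2norm v ^ 2 : ℝ) : ℂ) = star v ⬝ᵥ v := by
  rw [l2norm_sq]
  simp [dotProduct, Complex.conj_mul']

lemma norm_star_dotProduct_le (u v : ι → ℂ) : ‖star u ⬝ᵥ v‖ ≤ l2norm u * l2norm v := by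
  have h := norm_inner_le_norm (𝕜 := ℂ) (WithLp.toLp 2 u) (WithLp.toLp 2 v)
  rwa [EuclideanSpace.inner_toLp_toLp, dotProduct_comm] at h

lemma l2norm_mulVec_le {m n : ℕ} (A : Matrix (Fin m) (Fin n) ℂ) (v : Fin n → ℂ) :
    l2norm (A *ᵥ v) ≤ specNorm A * l2norm v :=
  (LinearMap.toContinuousLinearMap (Matrix.toEuclideanLin A)).le_opNorm (WithLp.toLp 2 v)

lemma l2norm_mulVec_of_conjTranspose_mul_self [DecidableEq κ] {A : Matrix ι κ ℂ}
    (hA : Aᴴ * A = 1) (v : κ → ℂ) : l2norm (A *ᵥ v) = l2norm v := by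
  rw [← sq_eq_sq₀ (l2norm_nonneg _) (l2norm_nonneg _)]
  apply Complex.ofReal_injective
  rw [ofReal_l2norm_sq, ofReal_l2norm_sq, star_mulVec, ← dotProduct_mulVec, mulVec_mulVec, hA,
    one_mulVec]

end Norms

lemma specNorm_nonneg {m n : ℕ} (A : Matrix (Fin m) (Fin n) ℂ) : 0 ≤ specNorm A := norm_nonneg _

lemma sigmaMin_nonneg {m n : ℕ} (A : Matrix (Fin m) (Fin n) ℂ) : 0 ≤ sigmaMin A :=
  LinearMap.singularValues_nonneg _ _

/-! ### Lower bounds from the smallest singular value. -/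

section SingularValues

open Module InnerProductSpace

variable {E F : Type*} [NormedAddCommGroup E] [InnerProductSpace ℂ E] [FiniteDimensional ℂ E]
  [NormedAddCommGroup F] [InnerProductSpace ℂ F] [FiniteDimensional ℂ F]

lemma norm_sq_apply_eq_sum_eigenvalues (T : E →ₗ[ℂ] F) {n : ℕ} (hn : finrank ℂ E = n) (v : E) :
    ‖T v‖ ^ 2 = ∑ i, T.isSymmetric_adjoint_comp_self.eigenvalues hn i *
      ‖(T.isSymmetric_adjoint_comp_self.eigenvectorBasis hn).repr v i‖ ^ 2 := by
  set hs := T.isSymmetric_adjoint_comp_self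
  set b := hs.eigenvectorBasis hn
  have h1 : ((‖T v‖ ^ 2 : ℝ) : ℂ) = inner ℂ v ((LinearMap.adjoint T ∘ₗ T) v) := by
    rw [LinearMap.comp_apply, LinearMap.adjoint_inner_right, inner_self_eq_norm_sq_to_K]
    simp
  apply Complex.ofReal_injective
  rw [h1, ← b.repr.inner_map_map, PiLp.inner_apply]
  rw [Complex.ofReal_sum]
  refine Finset.sum_congr rfl fun i _ => ?_
  rw [hs.eigenvectorBasis_apply_self_apply hn]
  simp only [RCLike.inner_apply]
  rw [mul_assoc, Complex.mul_conj', Complex.ofReal_mul, Complex.ofReal_pow]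
  rfl

lemma singularValues_last_mul_norm_le (T : E →ₗ[ℂ] F) {n : ℕ} (hn : finrank ℂ E = n)
    (hpos : 0 < n) (v : E) : T.singularValues (n - 1) * ‖v‖ ≤ ‖T v‖ := by
  rw [← sq_le_sq₀ (mul_nonneg (T.singularValues_nonneg _) (norm_nonneg _)) (norm_nonneg _),
    mul_pow, norm_sq_apply_eq_sum_eigenvalues T hn,
    ← (T.isSymmetric_adjoint_comp_self.eigenvectorBasis hn).repr.norm_map v,
    EuclideanSpace.norm_sq_eq, Finset.mul_sum]
  refine Finset.sum_le_sum fun i _ => mul_le_mul_of_nonneg_right ?_ (sq_nonneg _)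
  rw [T.sq_singularValues_of_lt hn (by omega)]
  exact T.isSymmetric_adjoint_comp_self.eigenvalues_antitone hn (Fin.mk_le_mk.2 (by omega))

lemma sigmaMin_mul_l2norm_le {m n : ℕ} (A : Matrix (Fin m) (Fin n) ℂ) (hn : 0 < n) (hnm : n ≤ m)
    (v : Fin n → ℂ) : sigmaMin A * l2norm v ≤ l2norm (A *ᵥ v) := by
  have h := singularValues_last_mul_norm_le (Matrix.toEuclideanLin A)
    (finrank_euclideanSpace_fin (𝕜 := ℂ) (n := n)) hn (WithLp.toLp 2 v)
  rw [sigmaMin, min_eq_right hnm]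
  exact h

/-- A wide `Aᵀ` has a kernel, so it is bounded below only on the range of its adjoint `A.map star`.
For `u` there, Cauchy-Schwarz gives `‖u‖² = ⟨w, Aᵀ u⟩ ≤ ‖w‖ ‖Aᵀ u‖`, while `sigmaMin A * ‖w‖ ≤ ‖u‖`.
-/
lemma sigmaMin_mul_l2norm_le_transpose {m n : ℕ} (A : Matrix (Fin m) (Fin n) ℂ) (hn : 0 < n)
    (hnm : n ≤ m) (w : Fin n → ℂ) :
    sigmaMin A * l2norm (A.map star *ᵥ w) ≤ l2norm (Aᵀ *ᵥ (A.map star *ᵥ w)) := by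
  set u := A.map star *ᵥ w with hu
  have hstar : star u = A *ᵥ star w := by
    ext i
    simp [hu, mulVec, dotProduct]
  have h1 : sigmaMin A * l2norm w ≤ l2norm u := by
    have := sigmaMin_mul_l2norm_le A hn hnm (star w)
    rwa [← hstar, l2norm_star, l2norm_star] at this
  have h2 : l2norm u ^ 2 ≤ l2norm w * l2norm (Aᵀ *ᵥ u) := by
    have h3 : star u ⬝ᵥ u = star w ⬝ᵥ (Aᵀ *ᵥ u) := by
      rw [hstar, dotProduct_mulVec (star w), vecMul_transpose]
    have h4 := norm_star_dotProduct_le w (Aᵀ *ᵥ u)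
    rw [← h3, ← ofReal_l2norm_sq, Complex.norm_real, Real.norm_of_nonneg (sq_nonneg _)] at h4
    exact h4
  rcases (l2norm_nonneg u).eq_or_lt with h0 | h0
  · rw [← h0, mul_zero]
    exact l2norm_nonneg _
  · refine le_of_mul_le_mul_right ?_ h0
    calc sigmaMin A * l2norm u * l2norm u = sigmaMin A * l2norm u ^ 2 := by ring
      _ ≤ sigmaMin A * (l2norm w * l2norm (Aᵀ *ᵥ u)) :=
        mul_le_mul_of_nonneg_left h2 (sigmaMin_nonneg A)
      _ = sigmaMin A * l2norm w * l2norm (Aᵀ *ᵥ u) := by ring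
      _ ≤ l2norm u * l2norm (Aᵀ *ᵥ u) := mul_le_mul_of_nonneg_right h1 (l2norm_nonneg _)
      _ = l2norm (Aᵀ *ᵥ u) * l2norm u := mul_comm _ _

end SingularValues

/-! ### Rectangular diagonal matrices, with coordinates indexed by `ℕ` to compare `Fin m` with `Fin
n`. -/

section RectDiagonal

/-- The extension of a finite vector to `ℕ` by zero. -/
def extendZero {n : ℕ} (a : Fin n → ℂ) (k : ℕ) : ℂ := if h : k < n then a ⟨k, h⟩ else 0

lemma l2norm_sq_eq_sum_range {n N : ℕ} (hN : n ≤ N) (a : Fin n → ℂ) :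
    l2norm a ^ 2 = ∑ k ∈ Finset.range N, ‖extendZero a k‖ ^ 2 := by
  have h : ∑ k ∈ Finset.range n, ‖extendZero a k‖ ^ 2 =
      ∑ k ∈ Finset.range N, ‖extendZero a k‖ ^ 2 := by
    refine Finset.sum_subset (Finset.range_subset_range.2 hN) fun k _ hk => ?_
    rw [Finset.mem_range] at hk
    simp [extendZero, hk]
  rw [l2norm_sq, ← h, Finset.sum_range]
  simp [extendZero]

lemma extendZero_rectDiagonal_mulVec {m n : ℕ} (σ : ℕ → ℝ) (a : Fin n → ℂ) (k : ℕ) :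
    extendZero (rectDiagonal m n σ *ᵥ a) k = if k < m then σ k * extendZero a k else 0 := by
  unfold extendZero
  split_ifs with h1 h2
  · rw [mulVec, dotProduct, Finset.sum_eq_single ⟨k, h2⟩]
    · simp [rectDiagonal]
    · intro j _ hj
      have : k ≠ j := fun h => hj (by ext; exact h.symm)
      simp [rectDiagonal, this]
    · simp
  · rw [mul_zero, mulVec, dotProduct]
    refine Finset.sum_eq_zero fun j _ => ?_
    have : k ≠ j := by omega
    simp [rectDiagonal, this]
  · rfl

lemma l2norm_rectDiagonal_mulVec_le {m n : ℕ} {σ : ℕ → ℝ} (hσ : ∀ i, 0 ≤ σ i) {τ : ℝ}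
    (hτ : 0 ≤ τ) (a : Fin n → ℂ) (h : ∀ k, k < m → extendZero a k ≠ 0 → σ k ≤ τ) :
    l2norm (rectDiagonal m n σ *ᵥ a) ≤ τ * l2norm a := by
  rw [← sq_le_sq₀ (l2norm_nonneg _) (mul_nonneg hτ (l2norm_nonneg _)), mul_pow,
    l2norm_sq_eq_sum_range (le_max_left m n), l2norm_sq_eq_sum_range (le_max_right m n),
    Finset.mul_sum]
  refine Finset.sum_le_sum fun k _ => ?_
  rw [extendZero_rectDiagonal_mulVec]
  split_ifs with hk
  · by_cases h0 : extendZero a k = 0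
    · simp [h0]
    · rw [norm_mul, mul_pow, Complex.norm_real, Real.norm_of_nonneg (hσ k)]
      exact mul_le_mul_of_nonneg_right (pow_le_pow_left₀ (hσ k) (h k hk h0) 2) (sq_nonneg _)
  · rw [norm_zero, zero_pow two_ne_zero]
    exact mul_nonneg (sq_nonneg _) (sq_nonneg _)

lemma le_l2norm_rectDiagonal_mulVec {m n : ℕ} {σ : ℕ → ℝ} {τ : ℝ} (hτ : 0 ≤ τ) (a : Fin n → ℂ)
    (h : ∀ k, extendZero a k ≠ 0 → k < m ∧ τ ≤ σ k) :
    τ * l2norm a ≤ l2norm (rectDiagonal m n σ *ᵥ a) := by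
  rw [← sq_le_sq₀ (mul_nonneg hτ (l2norm_nonneg _)) (l2norm_nonneg _), mul_pow,
    l2norm_sq_eq_sum_range (le_max_left m n), l2norm_sq_eq_sum_range (le_max_right m n),
    Finset.mul_sum]
  refine Finset.sum_le_sum fun k _ => ?_
  rw [extendZero_rectDiagonal_mulVec]
  by_cases h0 : extendZero a k = 0
  · simp [h0]
  · obtain ⟨hk, hle⟩ := h k h0
    rw [if_pos hk, norm_mul, mul_pow, Complex.norm_real, Real.norm_of_nonneg (hτ.trans hle)]
    exact mul_le_mul_of_nonneg_right (pow_le_pow_left₀ hτ hle 2) (sq_nonneg _)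

end RectDiagonal

/-! ### Variational bounds for singular values. -/

namespace IsSVD

variable {m n : ℕ} {A : Matrix (Fin m) (Fin n) ℂ} {Q : Matrix (Fin m) (Fin m) ℂ} {σ : ℕ → ℝ}
  {V : Matrix (Fin n) (Fin n) ℂ}

lemma left_mul_conjTranspose (h : IsSVD A Q σ V) : Q * Qᴴ = 1 :=
  mem_unitaryGroup_iff.1 h.left_unitary

lemma left_conjTranspose_mul (h : IsSVD A Q σ V) : Qᴴ * Q = 1 :=
  mem_unitaryGroup_iff'.1 h.left_unitary

lemma right_mul_conjTranspose (h : IsSVD A Q σ V) : V * Vᴴ = 1 :=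
  mem_unitaryGroup_iff.1 h.right_unitary

lemma right_conjTranspose_mul (h : IsSVD A Q σ V) : Vᴴ * V = 1 :=
  mem_unitaryGroup_iff'.1 h.right_unitary

lemma l2norm_left_conjTranspose_mulVec (h : IsSVD A Q σ V) (v : Fin m → ℂ) :
    l2norm (Qᴴ *ᵥ v) = l2norm v :=
  l2norm_mulVec_of_conjTranspose_mul_self
    (by rw [conjTranspose_conjTranspose, h.left_mul_conjTranspose]) v

lemma l2norm_left_mulVec (h : IsSVD A Q σ V) (v : Fin m → ℂ) : l2norm (Q *ᵥ v) = l2norm v :=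
  l2norm_mulVec_of_conjTranspose_mul_self h.left_conjTranspose_mul v

lemma l2norm_right_conjTranspose_mulVec (h : IsSVD A Q σ V) (v : Fin n → ℂ) :
    l2norm (Vᴴ *ᵥ v) = l2norm v :=
  l2norm_mulVec_of_conjTranspose_mul_self
    (by rw [conjTranspose_conjTranspose, h.right_mul_conjTranspose]) v

lemma l2norm_right_mulVec (h : IsSVD A Q σ V) (v : Fin n → ℂ) : l2norm (V *ᵥ v) = l2norm v :=
  l2norm_mulVec_of_conjTranspose_mul_self h.right_conjTranspose_mul v

lemma left_conjTranspose_mulVec_mulVec (h : IsSVD A Q σ V) (v : Fin n → ℂ) :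
    Qᴴ *ᵥ (A *ᵥ v) = rectDiagonal m n σ *ᵥ (Vᴴ *ᵥ v) := by
  rw [mulVec_mulVec, mulVec_mulVec, h.eq_mul, ← Matrix.mul_assoc, ← Matrix.mul_assoc,
    h.left_conjTranspose_mul, Matrix.one_mul]

lemma l2norm_mulVec (h : IsSVD A Q σ V) (v : Fin n → ℂ) :
    l2norm (A *ᵥ v) = l2norm (rectDiagonal m n σ *ᵥ (Vᴴ *ᵥ v)) := by
  rw [← h.left_conjTranspose_mulVec_mulVec, h.l2norm_left_conjTranspose_mulVec]

/-- The max-min lower bound for the singular values: if `A` expands an `S`-dimensional subspace by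
the factor `s`, then its `S`-th singular value is at least `s`. -/
lemma le_of_forall_le_l2norm_mulVec (h : IsSVD A Q σ V) {S : ℕ} (hS : 0 < S) (hSn : S ≤ n)
    (T : (Fin S → ℂ) →ₗ[ℂ] (Fin n → ℂ)) (hT : Function.Injective T) {s : ℝ}
    (hs : ∀ w, s * l2norm (T w) ≤ l2norm (A *ᵥ T w)) : s ≤ σ (S - 1) := by
  -- A kernel vector of `f` is one whose image under `T` is orthogonal to the first `S - 1` right
  -- singular vectors; only `σ k` with `k ≥ S - 1` act on it.
  let f : (Fin S → ℂ) →ₗ[ℂ] (Fin (S - 1) → ℂ) :=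
    (LinearMap.funLeft ℂ ℂ (Fin.castLE (by omega : S - 1 ≤ n))) ∘ₗ Vᴴ.mulVecLin ∘ₗ T
  obtain ⟨w, hw, hw0⟩ := (Submodule.ne_bot_iff _).1
    (f.ker_ne_bot_of_finrank_lt (by simp; omega))
  have hpos : 0 < l2norm (T w) := l2norm_pos fun h0 => hw0 (hT (by rw [h0, map_zero]))
  refine le_of_mul_le_mul_right ((hs w).trans ?_) hpos
  rw [h.l2norm_mulVec, ← h.l2norm_right_conjTranspose_mulVec (T w)]
  refine l2norm_rectDiagonal_mulVec_le h.nonneg (h.nonneg _) _ fun k _ hk0 => h.antitone ?_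
  by_contra hlt
  have := congrFun (LinearMap.mem_ker.1 hw) ⟨k, by omega⟩
  apply hk0
  rw [extendZero, dif_pos (by omega)]
  exact this

/-- The min-max upper bound for the singular values: if `A` is bounded by `e` on a subspace of
codimension at most `S`, then its singular values past the `S`-th one are at most `e`. -/
lemma le_of_forall_l2norm_mulVec_le (h : IsSVD A Q σ V) {S : ℕ} (hSm : S < m) (hSn : S < n)
    (T : (Fin n → ℂ) →ₗ[ℂ] (Fin S → ℂ)) {e : ℝ}
    (he : ∀ v, T v = 0 → l2norm (A *ᵥ v) ≤ e * l2norm v) : σ S ≤ e := by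
  -- The span of the first `S + 1` right singular vectors meets the kernel of `T`, and `A` expands
  -- it by at least `σ S`.
  let p : (Fin (S + 1) → ℂ) →ₗ[ℂ] (Fin n → ℂ) :=
    Function.ExtendByZero.linearMap ℂ (Fin.castLE (by omega : S + 1 ≤ n))
  obtain ⟨c, hc, hc0⟩ := (Submodule.ne_bot_iff _).1
    ((T ∘ₗ V.mulVecLin ∘ₗ p).ker_ne_bot_of_finrank_lt (by simp))
  have hinj := Fin.castLE_injective (by omega : S + 1 ≤ n)
  have hp0 : p c ≠ 0 := fun h0 => hc0 <| by
    ext k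
    have := congrFun h0 (Fin.castLE (by omega) k)
    simpa [p, hinj.extend_apply] using this
  refine le_of_mul_le_mul_right (le_trans ?_ (he (V *ᵥ p c) hc)) (l2norm_pos (v := V *ᵥ p c) ?_)
  · rw [h.l2norm_mulVec, mulVec_mulVec (p c), h.right_conjTranspose_mul, one_mulVec,
      h.l2norm_right_mulVec]
    refine le_l2norm_rectDiagonal_mulVec (h.nonneg _) _ fun k hk => ?_
    have hkS : k ≤ S := by
      by_contra hlt
      apply hk
      unfold extendZero
      split_ifs with hkn
      · refine Function.extend_apply' _ _ _ ?_
        rintro ⟨j, hj⟩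
        have := congrArg Fin.val hj
        simp at this
        omega
      · rfl
    exact ⟨by omega, h.antitone hkS⟩
  · intro h0
    apply hp0
    rw [← one_mulVec (p c), ← h.right_conjTranspose_mul, ← mulVec_mulVec, h0, mulVec_zero]

end IsSVD

/-! ### Perturbation of the noise space. -/

section NoiseBlock

variable {m n : ℕ}

/-- The orthogonal projection onto the coordinates with index at least `S`. -/
def tailPart (S : ℕ) (a : Fin m → ℂ) : Fin m → ℂ := fun i => if S ≤ (i : ℕ) then a i else 0

lemma l2norm_noiseBlock (S : ℕ) (Q : Matrix (Fin m) (Fin m) ℂ) (v : Fin m → ℂ) :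
    l2norm ((noiseBlock S Q)ᴴ *ᵥ v) = l2norm (tailPart S (Qᴴ *ᵥ v)) := by
  rw [← sq_eq_sq₀ (l2norm_nonneg _) (l2norm_nonneg _), l2norm_sq, l2norm_sq]
  have h0 (a : Fin m → ℂ) :
      ∑ i, ‖tailPart S a i‖ ^ 2 = ∑ i : Fin m, if S ≤ (i : ℕ) then ‖a i‖ ^ 2 else 0 :=
    Fintype.sum_congr _ _ fun i => by
      unfold tailPart
      split_ifs <;> simp
  rw [h0, ← Finset.sum_filter, Finset.sum_subtype _ (p := fun i : Fin m => S ≤ (i : ℕ)) (by simp)]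
  rfl

lemma l2norm_tailPart_le (S : ℕ) (a : Fin m → ℂ) : l2norm (tailPart S a) ≤ l2norm a := by
  rw [← sq_le_sq₀ (l2norm_nonneg _) (l2norm_nonneg _), l2norm_sq, l2norm_sq]
  refine Finset.sum_le_sum fun i _ => ?_
  unfold tailPart
  split_ifs <;> simp

lemma l2norm_sub_tailPart_le (S : ℕ) (a : Fin m → ℂ) :
    l2norm (a - tailPart S a) ≤ l2norm a := by
  rw [← sq_le_sq₀ (l2norm_nonneg _) (l2norm_nonneg _), l2norm_sq, l2norm_sq]
  refine Finset.sum_le_sum fun i _ => ?_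
  simp only [tailPart, Pi.sub_apply]
  split_ifs <;> simp

variable {A : Matrix (Fin m) (Fin n) ℂ} {Q : Matrix (Fin m) (Fin m) ℂ} {σ : ℕ → ℝ}
  {V : Matrix (Fin n) (Fin n) ℂ}

lemma IsSVD.l2norm_noiseBlock_le (h : IsSVD A Q σ V) (S : ℕ) (v : Fin m → ℂ) :
    l2norm ((noiseBlock S Q)ᴴ *ᵥ v) ≤ l2norm v := by
  rw [l2norm_noiseBlock, ← h.l2norm_left_conjTranspose_mulVec v]
  exact l2norm_tailPart_le _ _

lemma IsSVD.l2norm_noiseBlock_mulVec_le (h : IsSVD A Q σ V) (S : ℕ) {τ : ℝ} (hτ : 0 ≤ τ)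
    (hσ : ∀ i, S ≤ i → i < m → i < n → σ i ≤ τ) (v : Fin n → ℂ) :
    l2norm ((noiseBlock S Q)ᴴ *ᵥ (A *ᵥ v)) ≤ τ * l2norm v := by
  rw [l2norm_noiseBlock, h.left_conjTranspose_mulVec_mulVec,
    ← h.l2norm_right_conjTranspose_mulVec v]
  set a := Vᴴ *ᵥ v
  have : tailPart S (rectDiagonal m n σ *ᵥ a) = rectDiagonal m n σ *ᵥ tailPart S a := by
    ext i
    have h1 := extendZero_rectDiagonal_mulVec (m := m) σ a i
    have h2 := extendZero_rectDiagonal_mulVec (m := m) σ (tailPart S a) i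
    simp only [extendZero, i.isLt, dif_pos, if_true, Fin.eta] at h1 h2
    rw [h2, tailPart, h1]
    unfold tailPart
    split_ifs <;> simp_all
  rw [this]
  refine (l2norm_rectDiagonal_mulVec_le h.nonneg hτ _ fun k hk hk0 => ?_).trans
    (mul_le_mul_of_nonneg_left (l2norm_tailPart_le S a) hτ)
  have hkn : k < n := by
    by_contra hkn
    exact hk0 (dif_neg hkn)
  rw [extendZero, dif_pos hkn] at hk0
  refine hσ k ?_ hk hkn
  by_contra hkS
  exact hk0 (if_neg hkS)

/-- The one-sided comparison of two noise spaces behind the sine-theta theorem: if the second noise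
space is almost annihilated by the range of `A`, then the projection onto it is controlled by the
projection onto the noise space of `A`. -/
lemma IsSVD.l2norm_noiseBlock_le_add (h : IsSVD A Q σ V) {S : ℕ} (hS : 0 < S) (hSm : S ≤ m)
    (hSn : S ≤ n) {A' : Matrix (Fin m) (Fin n) ℂ} {Q' : Matrix (Fin m) (Fin m) ℂ} {σ' : ℕ → ℝ}
    {V' : Matrix (Fin n) (Fin n) ℂ} (h' : IsSVD A' Q' σ' V') {s t : ℝ} (hs : 0 < s) (ht : 0 ≤ t)
    (hσ : s ≤ σ (S - 1))
    (hA : ∀ v, l2norm ((noiseBlock S Q')ᴴ *ᵥ (A *ᵥ v)) ≤ t * l2norm v) (u : Fin m → ℂ) :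
    l2norm ((noiseBlock S Q')ᴴ *ᵥ u) ≤ l2norm ((noiseBlock S Q)ᴴ *ᵥ u) + t / s * l2norm u := by
  set a := Qᴴ *ᵥ u with ha
  have hu : u = Q *ᵥ tailPart S a + Q *ᵥ (a - tailPart S a) := by
    rw [← mulVec_add, add_sub_cancel, ha, mulVec_mulVec, h.left_mul_conjTranspose, one_mulVec]
  -- Inverting the first `S` singular values makes `V *ᵥ b` a preimage under `A` of the signal part
  -- of `u`.
  let b : Fin n → ℂ := fun j => if (j : ℕ) < S then extendZero a j / σ j else 0
  have hσpos : ∀ k, k < S → s ≤ σ k := fun k hk => hσ.trans (h.antitone (by omega))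
  have hb : rectDiagonal m n σ *ᵥ b = a - tailPart S a := by
    ext i
    have h1 := extendZero_rectDiagonal_mulVec (m := m) σ b i
    simp only [extendZero, i.isLt, dif_pos, if_true, Fin.eta] at h1
    rw [h1, Pi.sub_apply, tailPart]
    by_cases hi : (i : ℕ) < S
    · have h0 : (σ i : ℂ) ≠ 0 := Complex.ofReal_ne_zero.2 (hs.trans_le (hσpos i hi)).ne'
      rw [dif_pos (by omega), if_neg (by omega)]
      simp only [b, hi, if_true, extendZero, i.isLt, dif_pos, Fin.eta]
      field_simp
      simp
    · rw [if_pos (by omega)]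
      simp [b, hi]
  have hbu : l2norm b ≤ l2norm u / s := by
    rw [le_div_iff₀ hs, mul_comm]
    refine (le_l2norm_rectDiagonal_mulVec (m := m) (σ := σ) hs.le b fun k hk => ?_).trans ?_
    · have hkS : k < S := by
        by_contra hkS
        apply hk
        unfold extendZero
        split_ifs
        · exact if_neg hkS
        · rfl
      exact ⟨by omega, hσpos k hkS⟩
    · rw [hb, ← h.l2norm_left_conjTranspose_mulVec u]
      exact l2norm_sub_tailPart_le _ _
  have hAv : A *ᵥ (V *ᵥ b) = Q *ᵥ (a - tailPart S a) := by
    rw [← hb, h.eq_mul, mulVec_mulVec, mulVec_mulVec, Matrix.mul_assoc _ Vᴴ V,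
      h.right_conjTranspose_mul, Matrix.mul_one]
  calc l2norm ((noiseBlock S Q')ᴴ *ᵥ u)
      = l2norm ((noiseBlock S Q')ᴴ *ᵥ (Q *ᵥ tailPart S a)
          + (noiseBlock S Q')ᴴ *ᵥ (A *ᵥ (V *ᵥ b))) := by rw [hAv, ← mulVec_add, ← hu]
    _ ≤ l2norm (Q *ᵥ tailPart S a) + t * l2norm (V *ᵥ b) :=
        (l2norm_add_le _ _).trans (add_le_add (h'.l2norm_noiseBlock_le S _) (hA _))
    _ ≤ l2norm ((noiseBlock S Q)ᴴ *ᵥ u) + t * (l2norm u / s) := by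
        rw [h.l2norm_left_mulVec, h.l2norm_right_mulVec, l2norm_noiseBlock]
        exact add_le_add le_rfl (mul_le_mul_of_nonneg_left hbu ht)
    _ = _ := by ring

/-- A bound for the difference of the noise-space projections of a matrix `A` of rank at most `S`
and of a perturbation `A + E`. -/
lemma IsSVD.abs_l2norm_noiseBlock_sub_le {E : Matrix (Fin m) (Fin n) ℂ}
    {Q' : Matrix (Fin m) (Fin m) ℂ} {σ' : ℕ → ℝ} {V' : Matrix (Fin n) (Fin n) ℂ}
    (h : IsSVD A Q σ V) (h' : IsSVD (A + E) Q' σ' V') {S : ℕ} (hS : 0 < S) (hSm : S ≤ m)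
    (hSn : S ≤ n) (T : (Fin S → ℂ) →ₗ[ℂ] (Fin n → ℂ)) (hT : Function.Injective T) {g : ℝ}
    (hg : ∀ w, g * l2norm (T w) ≤ l2norm (A *ᵥ T w)) (K : (Fin n → ℂ) →ₗ[ℂ] (Fin S → ℂ))
    (hK : ∀ v, K v = 0 → A *ᵥ v = 0) (hE : 2 * specNorm E < g) (u : Fin m → ℂ) :
    |l2norm ((noiseBlock S Q')ᴴ *ᵥ u) - l2norm ((noiseBlock S Q)ᴴ *ᵥ u)| ≤
      2 * specNorm E / g * l2norm u := by
  set e := specNorm E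
  have he : 0 ≤ e := specNorm_nonneg E
  have hgpos : 0 < g := by linarith
  have hσ : g ≤ σ (S - 1) := h.le_of_forall_le_l2norm_mulVec hS hSn T hT hg
  have hσ' : g - e ≤ σ' (S - 1) := h'.le_of_forall_le_l2norm_mulVec hS hSn T hT fun w => by
    have h1 := l2norm_sub_le ((A + E) *ᵥ T w) (E *ᵥ T w)
    rw [← sub_mulVec, add_sub_cancel_right] at h1
    have h2 := l2norm_mulVec_le E (T w)
    have h3 := hg w
    linarith
  -- Indices start at `0`, so `σ S` is the singular value after the `S`-th.
  have hτ : ∀ i, S ≤ i → i < m → i < n → σ i ≤ 0 := fun i hSi him hin =>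
    (h.antitone hSi).trans <| h.le_of_forall_l2norm_mulVec_le (by omega) (by omega) K fun v hv => by
      rw [hK v hv, l2norm_zero, zero_mul]
  have hτ' : ∀ i, S ≤ i → i < m → i < n → σ' i ≤ e := fun i hSi him hin =>
    (h'.antitone hSi).trans <|
      h'.le_of_forall_l2norm_mulVec_le (by omega) (by omega) K fun v hv => by
        rw [add_mulVec, hK v hv, zero_add]
        exact l2norm_mulVec_le E v
  -- One `e` comes from the tail of `σ'`, the other from subtracting `E`.
  have hup := h.l2norm_noiseBlock_le_add hS hSm hSn h' hgpos (t := 2 * e) (by linarith) hσ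
    (fun v => by
      have h1 := l2norm_sub_le ((noiseBlock S Q')ᴴ *ᵥ ((A + E) *ᵥ v))
        ((noiseBlock S Q')ᴴ *ᵥ (E *ᵥ v))
      rw [← mulVec_sub, ← sub_mulVec, add_sub_cancel_right] at h1
      have h2 := h'.l2norm_noiseBlock_mulVec_le S he hτ' v
      have h3 := (h'.l2norm_noiseBlock_le S (E *ᵥ v)).trans (l2norm_mulVec_le E v)
      linarith) u
  -- The noise projection of `A` kills the range of `A`, so only `E` contributes.
  have hlow := h'.l2norm_noiseBlock_le_add hS hSm hSn h (by linarith : 0 < g - e) he hσ'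
    (fun v => by
      rw [add_mulVec, mulVec_add]
      have h1 := l2norm_add_le ((noiseBlock S Q)ᴴ *ᵥ (A *ᵥ v)) ((noiseBlock S Q)ᴴ *ᵥ (E *ᵥ v))
      have h2 := h.l2norm_noiseBlock_mulVec_le S le_rfl hτ v
      have h3 := (h.l2norm_noiseBlock_le S (E *ᵥ v)).trans (l2norm_mulVec_le E v)
      linarith) u
  have hfrac : e / (g - e) ≤ 2 * e / g := by
    rw [div_le_div_iff₀ (by linarith) hgpos]
    nlinarith
  have := mul_le_mul_of_nonneg_right hfrac (l2norm_nonneg u)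
  rw [abs_le]
  constructor <;> linarith

end NoiseBlock

/-! ### Vandermonde structure and existence of the maximum. -/

section Steering

lemma hankel_add {M L : ℕ} (hLM : L ≤ M) (y z : Fin (M + 1) → ℂ) :
    hankel hLM (y + z) = hankel hLM y + hankel hLM z := rfl

lemma hankel_fourierMatrix_mulVec {M L S : ℕ} (hLM : L ≤ M) (ω : Fin S → ℝ) (x : Fin S → ℂ) :
    hankel hLM (fourierMatrix M ω *ᵥ x) =
      fourierMatrix L ω * diagonal x * (fourierMatrix (M - L) ω)ᵀ := by
  ext i j
  rw [mul_apply]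
  change ∑ k, fourierMatrix M ω ⟨(i : ℕ) + (j : ℕ), by omega⟩ k * x k = _
  refine Fintype.sum_congr _ _ fun k => ?_
  rw [mul_diagonal, transpose_apply]
  simp only [fourierMatrix, of_apply, steering]
  rw [mul_right_comm (Complex.exp _), ← Complex.exp_add]
  congr 2
  push_cast
  ring

lemma xMin_nonneg {S : ℕ} (x : Fin S → ℂ) : 0 ≤ xMin x := Real.iInf_nonneg fun _ => norm_nonneg _

lemma xMin_mul_l2norm_le {S : ℕ} (x v : Fin S → ℂ) :
    xMin x * l2norm v ≤ l2norm (diagonal x *ᵥ v) := by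
  rw [← sq_le_sq₀ (mul_nonneg (xMin_nonneg x) (l2norm_nonneg _)) (l2norm_nonneg _), mul_pow,
    l2norm_sq, l2norm_sq, Finset.mul_sum]
  refine Finset.sum_le_sum fun i _ => ?_
  rw [mulVec_diagonal, norm_mul, mul_pow]
  exact mul_le_mul_of_nonneg_right
    (pow_le_pow_left₀ (xMin_nonneg x) (ciInf_le (Set.finite_range _).bddBelow i) 2) (sq_nonneg _)

lemma l2norm_steering_pos (L : ℕ) (t : ℝ) : 0 < l2norm (steering L t) :=
  l2norm_pos fun h => Complex.exp_ne_zero _ (congrFun h 0)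

lemma continuous_steering (L : ℕ) : Continuous (steering L) := by
  unfold steering
  fun_prop

lemma steering_add_one (L : ℕ) (t : ℝ) : steering L (t + 1) = steering L t := by
  ext k
  rw [steering, steering, Complex.exp_eq_exp_iff_exists_int]
  refine ⟨-(k : ℕ), ?_⟩
  push_cast
  ring

lemma continuous_l2norm {ι : Type*} [Fintype ι] : Continuous (l2norm : (ι → ℂ) → ℝ) :=
  (PiLp.continuous_toLp 2 _).norm

lemma continuous_noiseCorrelation {L : ℕ} (S : ℕ) (Q : Matrix (Fin (L + 1)) (Fin (L + 1)) ℂ) :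
    Continuous (noiseCorrelation S Q) :=
  (continuous_l2norm.comp (continuous_const.matrix_mulVec (continuous_steering L))).div
    (continuous_l2norm.comp (continuous_steering L)) fun t => (l2norm_steering_pos L t).ne'

lemma periodic_noiseCorrelation {L : ℕ} (S : ℕ) (Q : Matrix (Fin (L + 1)) (Fin (L + 1)) ℂ) :
    Function.Periodic (noiseCorrelation S Q) 1 := fun t => by
  rw [noiseCorrelation, noiseCorrelation, steering_add_one]

/-- `Ico 0 1` is not compact, but by periodicity it has the same image as `Icc 0 1`. -/
lemma exists_isGreatest_image_Ico_of_periodic {f : ℝ → ℝ} (hf : Continuous f)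
    (hp : Function.Periodic f 1) : ∃ t, IsGreatest (f '' Set.Ico (0 : ℝ) 1) (f t) := by
  have h : f '' Set.Ico (0 : ℝ) 1 = f '' Set.Icc (0 : ℝ) 1 := by
    have h1 := hp.image_Icc one_pos 0
    rw [zero_add] at h1
    rw [h1]
    refine (Set.image_subset_range _ _).antisymm ?_
    rintro _ ⟨t, rfl⟩
    obtain ⟨s, hs, hst⟩ := hp.exists_mem_Ico₀ one_pos t
    exact ⟨s, hs, hst.symm⟩
  obtain ⟨d, hd⟩ := ((isCompact_Icc (a := (0 : ℝ)) (b := 1)).image hf).exists_isGreatest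
    ((Set.nonempty_Icc.2 zero_le_one).image f)
  obtain ⟨t, -, rfl⟩ := hd.1
  exact ⟨t, h ▸ hd⟩

end Steering

end MUSIC

theorem proposition3p2 (M L S : ℕ) (hS : 1 ≤ S) (hLM : L ≤ M)
    (hM : 2 * S ≤ M + 1) (hSL : S ≤ L) (hSML : S ≤ M - L + 1)
    (ω : Fin S → ℝ) (hω : ∀ j, ω j ∈ Set.Ico (0 : ℝ) 1) (hω_inj : Function.Injective ω)
    (x : Fin S → ℂ) (hx : ∀ j, x j ≠ 0)
    (y₀ η y : Fin (M + 1) → ℂ)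
    (hy₀ : y₀ = (MUSIC.fourierMatrix M ω).mulVec x) (hy : y = y₀ + η)
    (Q : Matrix (Fin (L + 1)) (Fin (L + 1)) ℂ) (σ : ℕ → ℝ)
    (V : Matrix (Fin (M - L + 1)) (Fin (M - L + 1)) ℂ)
    (hsvd : MUSIC.IsSVD (MUSIC.hankel hLM y₀) Q σ V)
    (Q' : Matrix (Fin (L + 1)) (Fin (L + 1)) ℂ) (σ' : ℕ → ℝ)
    (V' : Matrix (Fin (M - L + 1)) (Fin (M - L + 1)) ℂ)
    (hsvd' : MUSIC.IsSVD (MUSIC.hankel hLM y) Q' σ' V')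
    (hη : 2 * MUSIC.specNorm (MUSIC.hankel hLM η) <
      MUSIC.xMin x * MUSIC.sigmaMin (MUSIC.fourierMatrix L ω) *
        MUSIC.sigmaMin (MUSIC.fourierMatrix (M - L) ω)) :
    ∃ d : ℝ,
      IsGreatest ((fun t : ℝ => |MUSIC.noiseCorrelation S Q' t - MUSIC.noiseCorrelation S Q t|) ''
        Set.Ico (0 : ℝ) 1) d ∧
      d ≤ 2 * MUSIC.specNorm (MUSIC.hankel hLM η) /
        (MUSIC.xMin x * MUSIC.sigmaMin (MUSIC.fourierMatrix L ω) *
          MUSIC.sigmaMin (MUSIC.fourierMatrix (M - L) ω)) := by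
  subst hy hy₀
  obtain ⟨t, ht⟩ := MUSIC.exists_isGreatest_image_Ico_of_periodic
    ((MUSIC.continuous_noiseCorrelation S Q').sub (MUSIC.continuous_noiseCorrelation S Q)).abs
    (fun t => by
      simp only [Pi.sub_apply]
      rw [MUSIC.periodic_noiseCorrelation S Q' t, MUSIC.periodic_noiseCorrelation S Q t])
  refine ⟨_, ht, ?_⟩
  rw [MUSIC.hankel_add] at hsvd'
  have hfact := MUSIC.hankel_fourierMatrix_mulVec hLM ω x
  set A := MUSIC.hankel hLM ((MUSIC.fourierMatrix M ω).mulVec x)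
  set Φ := MUSIC.fourierMatrix L ω
  set Ψ := MUSIC.fourierMatrix (M - L) ω
  have hx0 := MUSIC.xMin_nonneg x
  have hΦ0 := MUSIC.sigmaMin_nonneg Φ
  have hΨ0 := MUSIC.sigmaMin_nonneg Ψ
  have hpos : 0 < MUSIC.xMin x * MUSIC.sigmaMin Φ * MUSIC.sigmaMin Ψ :=
    (mul_nonneg zero_le_two (MUSIC.specNorm_nonneg _)).trans_lt hη
  have hΨpos : 0 < MUSIC.sigmaMin Ψ := pos_of_mul_pos_right hpos (mul_nonneg hx0 hΦ0)
  have hstar (w : Fin S → ℂ) : star ((Ψ.map star).mulVec w) = Ψ.mulVec (star w) := by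
    ext i
    simp [Matrix.mulVec, dotProduct]
  -- The range of `Ψ.map star` is the `S`-dimensional space on which `A` expands by `g`; `Ψᵀ`
  -- supplies the `S` equations whose solutions `A` kills.
  have hinj : Function.Injective (Ψ.map star).mulVecLin := by
    refine (injective_iff_map_eq_zero _).2 fun w hw => ?_
    by_contra hw0
    have h1 := MUSIC.sigmaMin_mul_l2norm_le Ψ hS hSML (star w)
    rw [← hstar, ← Matrix.mulVecLin_apply, hw, star_zero, MUSIC.l2norm_zero,
      MUSIC.l2norm_star] at h1
    exact (mul_pos hΨpos (MUSIC.l2norm_pos hw0)).not_ge h1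
  have hg (w : Fin S → ℂ) : MUSIC.xMin x * MUSIC.sigmaMin Φ * MUSIC.sigmaMin Ψ *
      MUSIC.l2norm ((Ψ.map star).mulVecLin w) ≤
        MUSIC.l2norm (A.mulVec ((Ψ.map star).mulVecLin w)) := by
    rw [hfact, ← Matrix.mulVec_mulVec, ← Matrix.mulVec_mulVec, Matrix.mulVecLin_apply]
    set u := (Ψ.map star).mulVec w
    calc _ = MUSIC.sigmaMin Φ * (MUSIC.xMin x * (MUSIC.sigmaMin Ψ * MUSIC.l2norm u)) := by ring
      _ ≤ MUSIC.sigmaMin Φ * (MUSIC.xMin x * MUSIC.l2norm (Ψ.transpose.mulVec u)) := by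
        gcongr
        exact MUSIC.sigmaMin_mul_l2norm_le_transpose Ψ hS hSML w
      _ ≤ MUSIC.sigmaMin Φ *
          MUSIC.l2norm ((Matrix.diagonal x).mulVec (Ψ.transpose.mulVec u)) := by
        gcongr
        exact MUSIC.xMin_mul_l2norm_le x _
      _ ≤ _ := MUSIC.sigmaMin_mul_l2norm_le Φ hS (by omega) _
  have hbound := hsvd.abs_l2norm_noiseBlock_sub_le hsvd' hS (by omega) hSML _ hinj hg
    Ψ.transpose.mulVecLin (fun v hv => by
      rw [Matrix.mulVecLin_apply] at hv
      rw [hfact, ← Matrix.mulVec_mulVec, hv, Matrix.mulVec_zero]) hη (MUSIC.steering L t)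
  have hφ := MUSIC.l2norm_steering_pos L t
  rw [Pi.sub_apply, MUSIC.noiseCorrelation, MUSIC.noiseCorrelation, ← sub_div, abs_div,
    abs_of_pos hφ, div_le_iff₀ hφ]
  exact hbound
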